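/- Let $(R,\mathfrak m)$ be a one-dimensional Noetherian local domain with infinite residue field and quotient field $K$. Assume that the integral closure $\overline R$ of $R$ in $K$ is a finite $R$-module and a discrete valuation ring (so $R$ is analytically irreducible), and that $R$ and $\overline R$ have the same residue field (residual rationality). Let $v$ be the normalized valuation of $\overline R$, write $\ell$ for the length of an $R$-module, $A:B=\{x\in K : xB\subseteq A\}$ and $A^*=R:A$ for $R$-submodules $A,B$ of $K$, and $v(A)=\{v(x): 0\ne x\in A\}$. Put $\gamma_R=R:\overline R$, $c=\ell(\overline R/\gamma_R)$, $\delta=\ell(\overline R/R)$, $n=c-\delta=\ell(R/\gamma_R)$. Let $s_0=0<s_1<s_2<\cdots$ be the elements of $v(R)$, let $R_i=\{x\in R: v(x)\ge s_i\}$, let $r_i=\ell\big((R:R_i)/(R:R_{i-1})\big)$ for $1\le i\le n$ (the type sequence of $R$), and let $r=r_1$ (the Cohen–Macaulay type of $R$). Let $I$ be an $\mathfrak m$-primary ideal of $R$ that is not principal, let $\Lambda=\bigcup_{m\ge 0}(I^m:I^m)$ be the blowing-up of $R$ along $I$, and put $$\Gamma=\{i\in\{1,\dots,n\} : s_{i-1}\in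 v(R:\Lambda)\},\qquad d(R:\Lambda)=\ell(\overline R/\Lambda^{**})-\sum_{i\in\Gamma}r_i .$$ The series $(1-z)\sum_{m\ge0}\ell(I^m/I^{m+1})z^m$ is a polynomial $h_I(z)\in\mathbb Z[z]$, and the genus $\rho=h_I'(1)$ of $I$ equals $\ell(\Lambda/R)$. Moreover: 1. $$\rho=\sum_{i\in\{1,\dots,n\}\setminus\Gamma}r_i-\ell(\Lambda^{**}/\Lambda)-d(R:\Lambda)\ \le\ r\cdot\ell\big(R/(R:\Lambda)\big).$$ If $\Lambda=\overline R$, then $\rho=\delta$ and $\ell(R/(R:\Lambda))=c-\delta$, so the inequality is Matlis' bound $\delta\le r(c-\delta)$. 2. There is an $i_0\in\mathbb N$ such that $s_{i_0}$ is the smallest element of $v(R:\Lambda)$, and for this $i_0$ $$\rho=\sum_{1\le i\le i_0}r_i-\ell(\Lambda^{**}/\Lambda)+\ell(\Lambda^{**}/R_{i_0}^*).$$ -/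

import Mathlib

open Polynomial

namespace Blowup

noncomputable section

/-- The length `ℓ_R(A / B)` as a natural number (used for `B ⊆ A` with quotient of finite length,
see `length_ne_top`). -/
def len {R : Type*} [CommRing R] {M : Type*} [AddCommGroup M] [Module R M]
    (A B : Submodule R M) : ℕ :=
  (Module.length R (A ⧸ B.submoduleOf A)).toNat

/-- Over a one-dimensional Noetherian domain, `A / B` has finite length as soon as `A` is finitely
generated and `a A ⊆ B` for some `a ≠ 0`; hence `len` is the honest length for all quotients of
nonzero ideals and fractional ideals below. -/
theorem length_ne_top {R M : Type*} [CommRing R] [IsDomain R] [IsNoetherianRing R]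
    [AddCommGroup M] [Module R M] (hdim : ringKrullDim R = 1)
    {A B : Submodule R M} (hA : A.FG) {a : R} (ha : a ≠ 0) (hB : ∀ x ∈ A, a • x ∈ B) :
    Module.length R (A ⧸ B.submoduleOf A) ≠ ⊤ := by
  have : Module.Finite R A := Module.Finite.iff_fg.mpr hA
  have htor : Module.IsTorsionBySet R (A ⧸ B.submoduleOf A) (Ideal.span {a} : Ideal R) := by
    rw [Module.isTorsionBySet_span_singleton_iff]
    intro x
    induction x using Submodule.Quotient.induction_on with
    | H x =>
      rw [← Submodule.Quotient.mk_smul, Submodule.Quotient.mk_eq_zero]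
      exact hB x x.2
  let _ : Module (R ⧸ (Ideal.span {a} : Ideal R)) (A ⧸ B.submoduleOf A) := htor.module
  have : IsScalarTower R (R ⧸ (Ideal.span {a} : Ideal R)) (A ⧸ B.submoduleOf A) :=
    htor.isScalarTower
  have hle : ringKrullDim (R ⧸ (Ideal.span {a} : Ideal R)) + 1 ≤ (1 : ℕ) := by
    have := hdim ▸
      ringKrullDim_quotient_succ_le_of_nonZeroDivisor (mem_nonZeroDivisors_of_ne_zero ha)
    simpa using this
  have : Ring.KrullDimLE 0 (R ⧸ (Ideal.span {a} : Ideal R)) := by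
    rw [Ring.krullDimLE_iff]
    refine ENat.WithBot.lt_add_one_iff.mp ?_
    simpa using ENat.WithBot.add_one_le_natCast_iff.mp hle
  have : IsArtinianRing (R ⧸ (Ideal.span {a} : Ideal R)) :=
    IsNoetherianRing.isArtinianRing_of_krullDimLE_zero
  have : Module.Finite (R ⧸ (Ideal.span {a} : Ideal R)) (A ⧸ B.submoduleOf A) :=
    Module.Finite.of_restrictScalars_finite R _ _
  have : IsArtinian R (A ⧸ B.submoduleOf A) :=
    isArtinian_of_surjective_algebraMap (R := R ⧸ (Ideal.span {a} : Ideal R))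
      Ideal.Quotient.mk_surjective
  exact Module.length_ne_top

/-- The Hilbert function `H_I(n) = ℓ_R(I^n / I^{n+1})`. -/
def hilbertFunction {R : Type*} [CommRing R] (I : Ideal R) (n : ℕ) : ℕ :=
  len (I ^ n) (I ^ (n + 1))

/-- The Hilbert-Poincaré series `P_I(z) = ∑ H_I(n) z^n`. -/
def hilbertSeries {R : Type*} [CommRing R] (I : Ideal R) : PowerSeries ℤ :=
  PowerSeries.mk fun n => (hilbertFunction I n : ℤ)

/-- `h` is the h-polynomial of `I`, i.e. `P_I(z) = h(z) / (1 - z)`. There is at most one such `h`.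
The genus of `I` is then `h'(1)`. -/
def IsHPolynomial {R : Type*} [CommRing R] (I : Ideal R) (h : ℤ[X]) : Prop :=
  (h : PowerSeries ℤ) = (1 - PowerSeries.X) * hilbertSeries I

section

variable {R : Type*} [CommRing R] (K : Type*) [Field K] [Algebra R K]

/-- The blowing-up `Λ(I) = ⋃_n (I^n : I^n)`, where `A : B = {x ∈ K | x B ⊆ A}` is the division of
submodules of `K`. The union is directed, see `mem_blowup`. -/
def blowup (I : Ideal R) : Submodule R K :=
  ⨆ n : ℕ, IsLocalization.coeSubmodule K (I ^ n) / IsLocalization.coeSubmodule K (I ^ n)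

theorem mem_blowup (I : Ideal R) (x : K) :
    x ∈ blowup K I ↔ ∃ n : ℕ,
      x ∈ IsLocalization.coeSubmodule K (I ^ n) / IsLocalization.coeSubmodule K (I ^ n) := by
  refine Submodule.mem_iSup_of_directed _ (Monotone.directed_le (monotone_nat_of_le_succ ?_))
  intro n y hy
  rw [Submodule.mem_div_iff_forall_mul_mem] at hy ⊢
  intro z hz
  rw [pow_succ, IsLocalization.coeSubmodule_mul] at hz ⊢
  induction hz using Submodule.mul_induction_on' with
  | mem_mul_mem a ha b hb => rw [← mul_assoc]; exact Submodule.mul_mem_mul (hy a ha) hb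
  | add a _ b _ h1 h2 => rw [mul_add]; exact add_mem h1 h2

/-- The dual `A^* = R : A` of a submodule `A` of the quotient field. -/
def dual (A : Submodule R K) : Submodule R K := 1 / A

variable (R)

/-- The integral closure `R̄` of `R` in `K`, as an `R`-submodule of `K`. -/
def Rbar : Submodule R K := Subalgebra.toSubmodule (integralClosure R K)

/-- The conductor ideal `γ_R = R : R̄`. -/
def conductor : Submodule R K := dual K (Rbar R K)

/-- `c = ℓ_R(R̄ / γ_R)`. -/
def c : ℕ := len (Rbar R K) (conductor R K)

/-- The singularity degree `δ = ℓ_R(R̄ / R)`. -/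
def delta : ℕ := len (Rbar R K) (1 : Submodule R K)

/-- `n = c - δ = ℓ_R(R / γ_R)`. -/
def n : ℕ := len (1 : Submodule R K) (conductor R K)

variable [IsDomain R] [IsDiscreteValuationRing (integralClosure R K)]

variable {R} in
/-- The normalized valuation of the discrete valuation ring `R̄`, restricted to `R`. -/
def val (x : R) : ℕ∞ :=
  IsDiscreteValuationRing.addVal (integralClosure R K) (algebraMap R (integralClosure R K) x)

variable {R} in
/-- The set of values `v(A)` of the nonzero elements of `A`, for `A` contained in `R`
(note that `val K 0 = ⊤`). -/
def values (A : Submodule R K) : Set ℕ :=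
  {s | ∃ x : R, algebraMap R K x ∈ A ∧ val K x = s}

/-- The increasing enumeration `s_0 = 0 < s_1 < ...` of the numerical semigroup `v(R)`. -/
def s (i : ℕ) : ℕ := Nat.nth (· ∈ values K (1 : Submodule R K)) i

/-- The ideal `R_i = {x ∈ R | v(x) ≥ s_i}`. -/
def Ri (i : ℕ) : Ideal R where
  carrier := {x | (s R K i : ℕ∞) ≤ val K x}
  zero_mem' := by simp [val]
  add_mem' {a b} ha hb := by
    simp only [Set.mem_ofPred_eq, val, map_add] at *
    exact (le_min ha hb).trans IsDiscreteValuationRing.addVal_add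
  smul_mem' a b hb := by
    simp only [Set.mem_ofPred_eq, val, smul_eq_mul, map_mul,
      IsDiscreteValuationRing.addVal_mul] at *
    exact hb.trans le_add_self

/-- The dual `R_i^* = R : R_i`. -/
def RiDual (i : ℕ) : Submodule R K := dual K (IsLocalization.coeSubmodule K (Ri R K i))

/-- The `i`-th entry `r_i = ℓ_R((R : R_i) / (R : R_{i-1}))` of the type sequence
(meaningful for `1 ≤ i ≤ n`); `r_1` is the Cohen-Macaulay type of `R`. -/
def r (i : ℕ) : ℕ := len (RiDual R K i) (RiDual R K (i - 1))

variable {R}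

open Classical in
/-- `Γ = {i ∈ {1, ..., n} | s_{i-1} ∈ v(R : Λ)}`. -/
def Gam (I : Ideal R) : Finset ℕ :=
  {i ∈ Finset.Icc 1 (n R K) | s R K (i - 1) ∈ values K (dual K (blowup K I))}

/-- `d(R : Λ) = ℓ_R(R̄ / Λ^{**}) - ∑_{i ∈ Γ} r_i`. -/
def d (I : Ideal R) : ℤ :=
  (len (Rbar R K) (dual K (dual K (blowup K I))) : ℤ) - ∑ i ∈ Gam K I, (r R K i : ℤ)

end

end

end Blowup

/-! All the lengths are read off from the chain R ⊆ Λ ⊆ Λ** ⊆ R̄, using additivity of length.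

Genus: if x has least value in I, then J = x⁻¹I lies between R and R̄, so its powers stabilise at a
ring B (`exists_reduction`). Hence I^m = x^m B for m ≥ N, so Λ = B, and the Hilbert function is
eventually e = ℓ(B/xB). Then h'(1) = N e - ∑_{m<N} H(m) = ℓ(B/x^N B) - ℓ(R/I^N), which is ℓ(Λ/R)
because x^N B = I^N.

Formulas: by residual rationality each R_i/R_{i+1} is simple, so γ_R = R_n and R_n* = R̄
(`RiDual_n_eq_Rbar`), while ∑_{i≤k} r_i telescopes to ℓ(R_k*/R) (`sum_r_eq_len`). Taking k = n gives
the first formula: the sum over Γ cancels against the one in d(R:Λ). Taking k = i₀ gives the second,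
since R:Λ ⊆ R_{i₀} dualises to R_{i₀}* ⊆ Λ**.

Bound: dualising a simple quotient produces length at most r (`len_dual_le_of_covBy`). Applied along
a chain from R:Λ to R this gives ℓ(Λ**/R) ≤ r ℓ(R/(R:Λ)), and Λ ⊆ Λ**. -/

namespace Blowup

/-! ### Additivity and invariance of length -/

section Length

variable {R M N : Type*} [CommRing R] [AddCommGroup M] [Module R M] [AddCommGroup N] [Module R N]

/-- Lengths of successive quotients add up. -/
theorem length_quot_add {A B C : Submodule R M} (hCB : C ≤ B) (hBA : B ≤ A) :
    Module.length R (A ⧸ C.submoduleOf A) =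
      Module.length R (B ⧸ C.submoduleOf B) + Module.length R (A ⧸ B.submoduleOf A) := by
  refine Module.length_eq_add_of_exact
    (Submodule.mapQ (C.submoduleOf B) (C.submoduleOf A) (Submodule.inclusion hBA) fun x hx => hx)
    (Submodule.factor (p := C.submoduleOf A) (p' := B.submoduleOf A) fun x hx => hCB hx)
    ?_ (Submodule.factor_surjective _) ?_
  · rw [← LinearMap.ker_eq_bot, LinearMap.ker_eq_bot']
    intro x
    induction x using Submodule.Quotient.induction_on with
    | H x =>
      intro hx
      rw [Submodule.Quotient.mk_eq_zero]
      exact (Submodule.Quotient.mk_eq_zero (C.submoduleOf A)).1 hx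
  · intro x
    induction x using Submodule.Quotient.induction_on with
    | H x =>
      constructor
      · intro hx
        have hx' : x ∈ B.submoduleOf A := by
          rw [← Submodule.Quotient.mk_eq_zero]
          exact hx
        exact ⟨Submodule.Quotient.mk ⟨x, hx'⟩, rfl⟩
      · rintro ⟨y, hy⟩
        induction y using Submodule.Quotient.induction_on with
        | H y =>
          rw [← hy]
          exact (Submodule.Quotient.mk_eq_zero (B.submoduleOf A)).2 y.2

theorem len_add {A B C : Submodule R M} (hCB : C ≤ B) (hBA : B ≤ A)
    (hfin : Module.length R (A ⧸ C.submoduleOf A) ≠ ⊤) : len A C = len A B + len B C := by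
  have h := length_quot_add hCB hBA
  rw [h, ne_eq, ENat.add_eq_top, not_or] at hfin
  rw [len, len, len, h, ENat.toNat_add hfin.1 hfin.2, add_comm]

/-- Serves both for multiplication by a nonzero element of K and for the embedding of R, which moves
lengths of ideals into K. -/
theorem length_map_map (f : M →ₗ[R] N) (hf : Function.Injective f) (A B : Submodule R M) :
    Module.length R (A.map f ⧸ (B.map f).submoduleOf (A.map f)) =
      Module.length R (A ⧸ B.submoduleOf A) := by
  refine (Submodule.Quotient.equiv _ _ (Submodule.equivMapOfInjective f hf A) ?_).length_eq.symm
  ext ⟨y, hy⟩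
  obtain ⟨x, hx, rfl⟩ := hy
  simp only [Submodule.mem_map, Submodule.submoduleOf, Submodule.mem_comap, Submodule.subtype_apply]
  constructor
  · rintro ⟨z, hz, hzx⟩
    exact ⟨z, hz, congrArg Subtype.val hzx⟩
  · rintro ⟨z, hz, hzx⟩
    obtain rfl := hf hzx
    exact ⟨⟨z, hx⟩, hz, rfl⟩

theorem len_map_map (f : M →ₗ[R] N) (hf : Function.Injective f) (A B : Submodule R M) :
    len (A.map f) (B.map f) = len A B := by
  rw [len, length_map_map f hf, len]

theorem len_self (A : Submodule R M) : len A A = 0 := by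
  have : Subsingleton (A ⧸ A.submoduleOf A) := by
    rw [Submodule.Quotient.subsingleton_iff, Submodule.submoduleOf_self]
  rw [len, Module.length_eq_zero, ENat.toNat_zero]

theorem len_pos_of_lt {A B : Submodule R M} (h : B < A)
    (hfin : Module.length R (A ⧸ B.submoduleOf A) ≠ ⊤) : 0 < len A B := by
  rw [len, Nat.pos_iff_ne_zero, ne_eq, ENat.toNat_eq_zero, not_or]
  refine ⟨fun h0 => h.not_ge ?_, hfin⟩
  rw [Module.length_eq_zero_iff, Submodule.Quotient.subsingleton_iff,
    Submodule.submoduleOf_eq_top] at h0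
  exact h0

theorem len_eq_one_of_covBy {A B : Submodule R M} (h : B ⋖ A) : len A B = 1 := by
  have : IsSimpleModule R (A ⧸ B.submoduleOf A) := (covBy_iff_quot_is_simple h.le).mp h
  rw [len, Module.length_eq_one, ENat.toNat_one]

theorem len_inf_eq_len_sup (A B : Submodule R M) : len A (A ⊓ B) = len (A ⊔ B) B := by
  rw [len, len]
  congr 1
  exact (LinearMap.quotientInfEquivSupQuotient A B).length_eq

/-- A covering pair of submodules over a local ring has quotient killed by the maximal ideal. -/
theorem smul_mem_of_covBy [IsLocalRing R] {A B : Submodule R M} (h : B ⋖ A) {a : R}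
    (ha : a ∈ IsLocalRing.maximalIdeal R) {x : M} (hx : x ∈ A) : a • x ∈ B := by
  have hs : IsSimpleModule R (A ⧸ B.submoduleOf A) := (covBy_iff_quot_is_simple h.le).mp h
  have hm := IsLocalRing.eq_maximalIdeal (IsSimpleModule.annihilator_isMaximal (R := R)
    (M := A ⧸ B.submoduleOf A))
  rw [← hm, Module.mem_annihilator] at ha
  have := ha (Submodule.Quotient.mk ⟨x, hx⟩)
  rw [← Submodule.Quotient.mk_smul, Submodule.Quotient.mk_eq_zero] at this
  exact this

theorem sum_len_telescope {F : ℕ → Submodule R M} (hF : Monotone F)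
    (hfin : ∀ i j, Module.length R (F i ⧸ (F j).submoduleOf (F i)) ≠ ⊤) (k : ℕ) :
    ∑ i ∈ Finset.Icc 1 k, len (F i) (F (i - 1)) = len (F k) (F 0) := by
  induction k with
  | zero => simp [len_self]
  | succ k ih =>
    rw [Finset.sum_Icc_succ_top (by lia), ih, Nat.add_sub_cancel,
      len_add (hF (Nat.zero_le k)) (hF (Nat.le_succ k)) (hfin _ _), add_comm]

end Length

/-! ### Duality of fractional ideals and the bound by the type -/

section Field

variable {R K : Type*} [CommRing R] [Field K] [Algebra R K]

theorem span_singleton_mul_eq_map (y : K) (A : Submodule R K) :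
    Submodule.span R {y} * A = A.map (LinearMap.mulLeft R y) := by
  ext z
  rw [Submodule.mem_span_singleton_mul]
  rfl

theorem len_span_singleton_mul {y : K} (hy : y ≠ 0) (A B : Submodule R K) :
    len (Submodule.span R {y} * A) (Submodule.span R {y} * B) = len A B := by
  rw [span_singleton_mul_eq_map, span_singleton_mul_eq_map]
  exact len_map_map _ (mul_right_injective₀ hy) A B

theorem mem_dual {A : Submodule R K} {x : K} :
    x ∈ dual K A ↔ ∀ y ∈ A, ∃ b : R, algebraMap R K b = x * y := by
  rw [dual, Submodule.mem_div_iff_forall_mul_mem]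
  simp only [Submodule.mem_one]

theorem dual_anti {A B : Submodule R K} (h : A ≤ B) : dual K B ≤ dual K A := fun _ hx =>
  mem_dual.2 fun y hy => mem_dual.1 hx y (h hy)

theorem le_dual_dual (A : Submodule R K) : A ≤ dual K (dual K A) := fun _ hx =>
  mem_dual.2 fun y hy => by
    rw [mul_comm]
    exact mem_dual.1 hy _ hx

theorem dual_one : dual K (1 : Submodule R K) = 1 := by
  ext x
  rw [dual, Submodule.mem_div_iff_forall_mul_mem]
  refine ⟨fun h => by simpa using h 1 (Submodule.one_le.1 le_rfl), fun h y hy => ?_⟩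
  simpa using Submodule.mul_mem_mul h hy

variable [IsDomain R] [IsFractionRing R K]

theorem exists_ne_zero_algebraMap_mem {A : Submodule R K} (hA : A ≠ ⊥) :
    ∃ a : R, a ≠ 0 ∧ algebraMap R K a ∈ A := by
  obtain ⟨x, hx, hx0⟩ := A.ne_bot_iff.1 hA
  obtain ⟨p, q, hq, rfl⟩ := IsFractionRing.div_surjective (A := R) x
  have hq0 := IsFractionRing.to_map_ne_zero_of_mem_nonZeroDivisors (K := K) hq
  refine ⟨p, ?_, ?_⟩
  · rintro rfl
    simp at hx0
  · have := A.smul_mem q hx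
    rwa [Algebra.smul_def, mul_div_cancel₀ _ hq0] at this

theorem dual_ne_bot {A : Submodule R K} (hA : A.FG) : dual K A ≠ ⊥ := by
  obtain ⟨a, ha, h⟩ := FractionalIdeal.isFractional_of_fg (S := nonZeroDivisors R) hA
  have ha' := IsFractionRing.to_map_ne_zero_of_mem_nonZeroDivisors (K := K) ha
  refine (Submodule.ne_bot_iff _).2 ⟨algebraMap R K a, mem_dual.2 fun y hy => ?_, ha'⟩
  obtain ⟨b, hb⟩ := h y hy
  exact ⟨b, by rw [hb, Algebra.smul_def]⟩

variable [IsNoetherianRing R]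

/-- A nonzero a ∈ A ∩ R forces R : A ⊆ a⁻¹R, a Noetherian module. -/
theorem fg_dual {A : Submodule R K} (hA : A ≠ ⊥) : (dual K A).FG := by
  obtain ⟨a, ha, haA⟩ := exists_ne_zero_algebraMap_mem hA
  have ha' : algebraMap R K a ≠ 0 := by simpa using ha
  have hle : dual K A ≤ (1 : Submodule R K).map (LinearMap.mulLeft R (algebraMap R K a)⁻¹) := by
    intro x hx
    obtain ⟨b, hb⟩ := mem_dual.1 hx _ haA
    refine ⟨algebraMap R K b, Submodule.mem_one.2 ⟨b, rfl⟩, ?_⟩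
    rw [LinearMap.mulLeft_apply, hb]
    field_simp
  have h1 : (1 : Submodule R K).FG := by
    rw [Submodule.one_eq_span]
    exact Submodule.fg_span_singleton 1
  exact (h1.map _).of_le hle

/-- A common denominator a of A and a nonzero b ∈ B ∩ R satisfy b a A ⊆ b R ⊆ B. -/
theorem length_ne_top_of_fg (hdim : ringKrullDim R = 1) {A B : Submodule R K} (hA : A.FG)
    (hB : B ≠ ⊥) : Module.length R (A ⧸ B.submoduleOf A) ≠ ⊤ := by
  obtain ⟨b, hb, hbB⟩ := exists_ne_zero_algebraMap_mem hB
  obtain ⟨a, ha, h⟩ := FractionalIdeal.isFractional_of_fg (S := nonZeroDivisors R) hA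
  refine length_ne_top hdim hA (mul_ne_zero hb (nonZeroDivisors.ne_zero ha)) fun x hx => ?_
  obtain ⟨e, he⟩ := h x hx
  have : (b * a) • x = e • algebraMap R K b := by
    rw [mul_smul, ← he, Algebra.smul_def, Algebra.smul_def, mul_comm]
  rw [this]
  exact B.smul_mem _ hbB

/-- If `B ⊆ A` has simple quotient over a local ring, then the length of `(R : B) / (R : A)` is at
most that of `(R : 𝔪) / R`. -/
theorem len_dual_le_of_covBy [IsLocalRing R] (hdim : ringKrullDim R = 1) {A B : Submodule R K}
    (hm : IsLocalRing.maximalIdeal R ≠ ⊥) (h : B ⋖ A) :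
    len (dual K B) (dual K A) ≤
      len (dual K (IsLocalization.coeSubmodule K (IsLocalRing.maximalIdeal R))) 1 := by
  obtain ⟨x, hxA, hxB⟩ := Set.exists_of_ssubset h.lt
  have hx0 : x ≠ 0 := fun h0 => hxB (h0 ▸ B.zero_mem)
  have hA : ∀ z ∈ A, ∃ y ∈ B, ∃ a : R, y + a • x = z := by
    have : B ⊔ Submodule.span R {x} = A :=
      (h.eq_or_eq le_sup_left (sup_le h.le (by simpa using hxA))).resolve_left fun h' =>
        hxB (h' ▸ Submodule.mem_sup_right (Submodule.mem_span_singleton_self x))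
    intro z hz
    rw [← this, Submodule.mem_sup] at hz
    obtain ⟨y, hy, w, hw, rfl⟩ := hz
    obtain ⟨a, rfl⟩ := Submodule.mem_span_singleton.1 hw
    exact ⟨y, hy, a, rfl⟩
  -- Since A = B + Rx, an element z of R : B lies in R : A exactly when x z ∈ R.
  have hinf : Submodule.span R {x} * dual K A = (Submodule.span R {x} * dual K B) ⊓ 1 := by
    ext w
    simp only [Submodule.mem_inf, Submodule.mem_span_singleton_mul]
    constructor
    · rintro ⟨z, hz, rfl⟩
      refine ⟨⟨z, dual_anti h.le hz, rfl⟩, ?_⟩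
      obtain ⟨b, hb⟩ := mem_dual.1 hz x hxA
      exact Submodule.mem_one.2 ⟨b, by rw [hb, mul_comm]⟩
    · rintro ⟨⟨z, hz, rfl⟩, hw⟩
      refine ⟨z, mem_dual.2 fun u hu => ?_, rfl⟩
      obtain ⟨y, hy, a, rfl⟩ := hA u hu
      obtain ⟨b, hb⟩ := mem_dual.1 hz y hy
      obtain ⟨e, he⟩ := Submodule.mem_one.1 hw
      exact ⟨b + a * e, by rw [map_add, map_mul, hb, he, Algebra.smul_def]; ring⟩
  set D := dual K (IsLocalization.coeSubmodule K (IsLocalRing.maximalIdeal R))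
  have hmK : IsLocalization.coeSubmodule K (IsLocalRing.maximalIdeal R) ≠ ⊥ := by
    rw [ne_eq, ← IsLocalization.coeSubmodule_bot K (R := R),
      (IsFractionRing.coeSubmodule_injective R K).eq_iff]
    exact hm
  have h1D : (1 : Submodule R K) ≤ D := by
    have := dual_anti (IsLocalization.coeSubmodule_mono K
      (le_top (a := IsLocalRing.maximalIdeal R)))
    rwa [IsLocalization.coeSubmodule_top, dual_one] at this
  -- Simplicity of A/B gives 𝔪x ⊆ B, so x(R : B) multiplies 𝔪 into R.
  have hle : Submodule.span R {x} * dual K B ⊔ 1 ≤ D := by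
    refine sup_le (fun w hw => ?_) h1D
    obtain ⟨z, hz, rfl⟩ := Submodule.mem_span_singleton_mul.1 hw
    refine mem_dual.2 fun y hy => ?_
    obtain ⟨a, ha, rfl⟩ := (IsLocalization.mem_coeSubmodule K _).1 hy
    obtain ⟨b, hb⟩ := mem_dual.1 hz _ (smul_mem_of_covBy h ha hxA)
    exact ⟨b, by rw [hb, Algebra.smul_def]; ring⟩
  -- After scaling by x, the second isomorphism theorem embeds the quotient of duals into (R : 𝔪)/R.
  rw [← len_span_singleton_mul hx0, hinf, len_inf_eq_len_sup,
    len_add le_sup_right hle (length_ne_top_of_fg hdim (fg_dual hmK) one_ne_zero)]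
  exact Nat.le_add_left _ _

/-- The length of `(R : B) / (R : A)` is at most the Cohen-Macaulay type times that of `A / B`. -/
theorem len_dual_le [IsLocalRing R] (hdim : ringKrullDim R = 1)
    (hm : IsLocalRing.maximalIdeal R ≠ ⊥) {A B : Submodule R K} (hA : A.FG) (hB : B ≠ ⊥)
    (h : B ≤ A) :
    len (dual K B) (dual K A) ≤
      len (dual K (IsLocalization.coeSubmodule K (IsLocalRing.maximalIdeal R))) 1 * len A B := by
  induction hk : len A B using Nat.strong_induction_on generalizing A B with
  | _ k ih =>
    rcases h.eq_or_lt with rfl | hlt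
    · simp [len_self]
    by_cases hcov : B ⋖ A
    · rw [← hk, len_eq_one_of_covBy hcov, mul_one]
      exact len_dual_le_of_covBy hdim hm hcov
    -- An intermediate C splits both lengths; both pieces of A/B are strictly shorter.
    · obtain ⟨C, hBC, hCA⟩ := exists_lt_lt_of_not_covBy hlt hcov
      have hC : C ≠ ⊥ := ne_bot_of_le_ne_bot hB hBC.le
      have hCfg : C.FG := hA.of_le hCA.le
      have h1 := len_add hBC.le hCA.le (length_ne_top_of_fg hdim hA hB)
      have h2 := len_pos_of_lt hCA (length_ne_top_of_fg hdim hA hC)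
      have h3 := len_pos_of_lt hBC (length_ne_top_of_fg hdim hCfg hB)
      have h4 := len_add (dual_anti hCA.le) (dual_anti hBC.le)
        (length_ne_top_of_fg hdim (fg_dual hB) (dual_ne_bot hA))
      have h5 := ih _ (by lia) hA hC hCA.le rfl
      have h6 := ih _ (by lia) hCfg hB hBC.le rfl
      rw [h4, ← hk, h1, mul_add, add_comm]
      exact add_le_add h5 h6

end Field

/-! ### Telescoping along descending chains -/

section Telescope

variable {R M : Type*} [CommRing R] [AddCommGroup M] [Module R M]

theorem sum_len_antitone {F : ℕ → Submodule R M} (hF : Antitone F)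
    (hfin : ∀ i j, Module.length R (F i ⧸ (F j).submoduleOf (F i)) ≠ ⊤) (k : ℕ) :
    ∑ i ∈ Finset.range k, len (F i) (F (i + 1)) = len (F 0) (F k) := by
  induction k with
  | zero => simp [len_self]
  | succ k ih =>
    rw [Finset.sum_range_succ, ih, ← len_add (hF (Nat.le_succ k)) (hF (Nat.zero_le k)) (hfin _ _)]

end Telescope

/-! ### The h-polynomial of an eventually constant Hilbert function -/

section HPolynomial

/-- An ideal whose Hilbert function is eventually constant has an `h`-polynomial, whose derivative
at `1` is computed from the first values of the Hilbert function. -/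
theorem exists_isHPolynomial {R : Type*} [CommRing R] (I : Ideal R) {N e : ℕ}
    (hN : ∀ m, N ≤ m → hilbertFunction I m = e) :
    ∃ h : ℤ[X], IsHPolynomial I h ∧
      (derivative h).eval 1 = N * e - ∑ m ∈ Finset.range N, (hilbertFunction I m : ℤ) := by
  set p : ℤ[X] := ∑ m ∈ Finset.range N, C (hilbertFunction I m : ℤ) * X ^ m with hp
  refine ⟨C (e : ℤ) * X ^ N + (1 - X) * p, ?_, ?_⟩
  -- The series is its truncation below N plus the constant tail e z^N/(1 - z).
  · have hser : hilbertSeries I =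
        (p : PowerSeries ℤ) + PowerSeries.C (e : ℤ) * PowerSeries.X ^ N * PowerSeries.mk 1 := by
      ext m
      rw [hilbertSeries, PowerSeries.coeff_mk, map_add, Polynomial.coeff_coe, hp,
        Polynomial.finsetSum_coeff, mul_assoc, PowerSeries.coeff_C_mul,
        PowerSeries.coeff_X_pow_mul']
      simp only [Polynomial.coeff_C_mul_X_pow, Finset.sum_ite_eq, Finset.mem_range]
      by_cases h : m < N
      · simp [h, h.not_ge]
      · simp [h, not_lt.1 h, hN m (not_lt.1 h)]
    rw [IsHPolynomial, hser, Polynomial.coe_add, Polynomial.coe_mul, Polynomial.coe_mul,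
      Polynomial.coe_sub, Polynomial.coe_pow, Polynomial.coe_C, Polynomial.coe_X,
      Polynomial.coe_one]
    linear_combination (-PowerSeries.C (e : ℤ) * PowerSeries.X ^ N) *
      PowerSeries.mk_one_mul_one_sub_eq_one ℤ
  · have h1 : p.eval 1 = ∑ m ∈ Finset.range N, (hilbertFunction I m : ℤ) := by
      simp [hp, Polynomial.eval_finsetSum]
    simp [h1, Polynomial.derivative_X_pow]
    ring

end HPolynomial

/-! ### Reductions, the blowing-up and the genus -/

section Reduction

variable {R K : Type*} [CommRing R] [Field K] [Algebra R K]

theorem one_le_Rbar : (1 : Submodule R K) ≤ Rbar R K :=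
  Submodule.one_le.2 (integralClosure R K).one_mem

theorem fg_Rbar [Module.Finite R (integralClosure R K)] : (Rbar R K).FG :=
  Module.Finite.iff_fg.mp ‹Module.Finite R (integralClosure R K)›

theorem coeSubmodule_pow (I : Ideal R) (m : ℕ) :
    IsLocalization.coeSubmodule K (I ^ m) = IsLocalization.coeSubmodule K I ^ m := by
  induction m with
  | zero => rw [pow_zero, pow_zero, Ideal.one_eq_top, IsLocalization.coeSubmodule_top]
  | succ m ih => rw [pow_succ, pow_succ, IsLocalization.coeSubmodule_mul, ih]

theorem pow_le_Rbar {J : Submodule R K} (hJ : J ≤ Rbar R K) (m : ℕ) : J ^ m ≤ Rbar R K := by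
  induction m with
  | zero => exact one_le_Rbar
  | succ m ih =>
    rw [pow_succ, Submodule.mul_le]
    exact fun a ha b hb => (integralClosure R K).mul_mem (ih ha) (hJ hb)

/-- The powers of a submodule between `1` and the integral closure become stationary. -/
theorem exists_pow_stable [IsNoetherianRing R] [Module.Finite R (integralClosure R K)]
    {J : Submodule R K} (h1 : 1 ≤ J) (hJ : J ≤ Rbar R K) : ∃ N, ∀ m, N ≤ m → J ^ m = J ^ N := by
  have : IsNoetherian R (Rbar R K) := isNoetherian_of_fg_of_noetherian _ fg_Rbar
  obtain ⟨N, hN⟩ := monotone_stabilizes_iff_noetherian.2 this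
    ⟨fun m => (J ^ m).submoduleOf (Rbar R K), fun a b hab x hx => pow_le_pow_right₀ h1 hab hx⟩
  refine ⟨N, fun m hm => le_antisymm (fun x hx => ?_) (pow_le_pow_right₀ h1 hm)⟩
  have hx' : (⟨x, pow_le_Rbar hJ m hx⟩ : Rbar R K) ∈ (J ^ m).submoduleOf (Rbar R K) := hx
  exact (hN m hm).ge hx'

/-- For m ≥ N the quotient I^m : I^m is x^m B : x^m B = B : B = B, as B is a ring containing 1. -/
theorem blowup_eq_of_reduction {I : Ideal R} {x : K} (hx : x ≠ 0) {N : ℕ} {B : Submodule R K}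
    (h1 : 1 ≤ B) (hBB : B * B = B)
    (hB : ∀ m, N ≤ m → IsLocalization.coeSubmodule K (I ^ m) = Submodule.span R {x ^ m} * B) :
    blowup K I = B := by
  ext z
  rw [mem_blowup]
  constructor
  · rintro ⟨m, hm⟩
    rw [Submodule.mem_div_iff_forall_mul_mem] at hm
    -- The exponent m + N is large enough for `hB`, and multiplication by z still preserves I^(m+N)
    -- = I^m I^N.
    have hxm : x ^ (m + N) ≠ 0 := pow_ne_zero _ hx
    have hmem : x ^ (m + N) ∈ IsLocalization.coeSubmodule K (I ^ (m + N)) := by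
      rw [hB _ (Nat.le_add_left N m)]
      exact Submodule.mem_span_singleton_mul.2 ⟨1, Submodule.one_le.1 h1, mul_one _⟩
    have hz : z * x ^ (m + N) ∈ IsLocalization.coeSubmodule K (I ^ (m + N)) := by
      rw [pow_add I, IsLocalization.coeSubmodule_mul] at hmem ⊢
      generalize x ^ (m + N) = y at hmem
      induction hmem using Submodule.mul_induction_on' with
      | mem_mul_mem a ha b hb => rw [← mul_assoc]; exact Submodule.mul_mem_mul (hm a ha) hb
      | add a _ b _ h1 h2 => rw [mul_add]; exact add_mem h1 h2
    rw [hB _ (Nat.le_add_left N m)] at hz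
    obtain ⟨w, hw, hwz⟩ := Submodule.mem_span_singleton_mul.1 hz
    rw [mul_comm z] at hwz
    rwa [← mul_left_cancel₀ hxm hwz]
  · intro hz
    refine ⟨N, Submodule.mem_div_iff_forall_mul_mem.2 fun y hy => ?_⟩
    rw [hB N le_rfl] at hy ⊢
    obtain ⟨w, hw, rfl⟩ := Submodule.mem_span_singleton_mul.1 hy
    exact Submodule.mem_span_singleton_mul.2
      ⟨z * w, hBB ▸ Submodule.mul_mem_mul hz hw, by ring⟩

variable [IsNoetherianRing R] [IsFractionRing R K]
  [Module.Finite R (integralClosure R K)] [IsDiscreteValuationRing (integralClosure R K)]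

/-- An element of minimal value generates a reduction of `I`: there is a ring `B` between `R` and its
integral closure with `I ^ m = x ^ m B` for all large `m`. -/
theorem exists_reduction {I : Ideal R} (hI : I ≠ ⊥) :
    ∃ (x : R) (N : ℕ) (B : Submodule R K), x ≠ 0 ∧ 1 ≤ B ∧ B ≤ Rbar R K ∧ B * B = B ∧
      ∀ m, N ≤ m → IsLocalization.coeSubmodule K (I ^ m) =
        Submodule.span R {algebraMap R K x ^ m} * B := by
  obtain ⟨y, hyI, hy0⟩ := I.ne_bot_iff.1 hI
  obtain ⟨x, ⟨hxI, hx0⟩, hmin⟩ := exists_minimalFor_of_wellFoundedLT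
    (fun y : R => y ∈ I ∧ y ≠ 0) (val K) ⟨y, hyI, hy0⟩
  have hxK : algebraMap R K x ≠ 0 := by simpa using hx0
  set J : Submodule R K :=
    Submodule.span R {(algebraMap R K x)⁻¹} * IsLocalization.coeSubmodule K I with hJdef
  have h1 : 1 ≤ J := Submodule.one_le.2 <| Submodule.mem_span_singleton_mul.2
    ⟨algebraMap R K x, (IsLocalization.mem_coeSubmodule K I).2 ⟨x, hxI, rfl⟩, inv_mul_cancel₀ hxK⟩
  -- Minimality of v(x) makes x divide every element of I in the valuation ring R̄.
  have hJ : J ≤ Rbar R K := by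
    intro z hz
    obtain ⟨w, hw, rfl⟩ := Submodule.mem_span_singleton_mul.1 hz
    obtain ⟨y, hy, rfl⟩ := (IsLocalization.mem_coeSubmodule K I).1 hw
    rcases eq_or_ne y 0 with rfl | hy0
    · simp
    have hle : val K x ≤ val K y := by
      rcases le_total (val K x) (val K y) with h | h
      · exact h
      · exact hmin ⟨hy, hy0⟩ h
    obtain ⟨u, hu⟩ := IsDiscreteValuationRing.addVal_le_iff_dvd.1 hle
    have huK : algebraMap R K y = algebraMap R K x * u := congrArg Subtype.val hu
    rw [huK, inv_mul_cancel_left₀ hxK]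
    exact u.2
  obtain ⟨N, hN⟩ := exists_pow_stable h1 hJ
  refine ⟨x, N, J ^ N, hx0, one_le_pow₀ h1, pow_le_Rbar hJ N, ?_, fun m hm => ?_⟩
  · rw [← pow_add, hN _ (Nat.le_add_left N N)]
  · have : IsLocalization.coeSubmodule K I = Submodule.span R {algebraMap R K x} * J := by
      rw [hJdef, ← mul_assoc, Submodule.span_mul_span, Set.singleton_mul_singleton,
        mul_inv_cancel₀ hxK, ← Submodule.one_eq_span, one_mul]
    rw [coeSubmodule_pow, this, mul_pow, hN m hm, Submodule.span_pow, Set.singleton_pow]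

/-- The blowing-up is contained in the integral closure, and the genus of `I` is the length of
`Λ / R`. -/
theorem blowup_le_Rbar_and_genus [IsDomain R] (hdim : ringKrullDim R = 1) {I : Ideal R} (hI : I ≠ ⊥) :
    (1 ≤ blowup K I ∧ blowup K I ≤ Rbar R K) ∧
    ∃ h : ℤ[X], IsHPolynomial I h ∧ (derivative h).eval 1 = (len (blowup K I) 1 : ℤ) := by
  obtain ⟨x, N, B, hx0, h1, hBR, hBB, hB⟩ := exists_reduction (K := K) hI
  have hxK : algebraMap R K x ≠ 0 := by simpa using hx0
  rw [blowup_eq_of_reduction hxK h1 hBB hB]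
  refine ⟨⟨h1, hBR⟩, ?_⟩
  have hBfg : B.FG := fg_Rbar.of_le hBR
  have hB0 : B ≠ ⊥ := ne_bot_of_le_ne_bot one_ne_zero h1
  have hfin : ∀ {A C : Submodule R K}, A.FG → C ≠ ⊥ →
      Module.length R (A ⧸ C.submoduleOf A) ≠ ⊤ := length_ne_top_of_fg hdim
  have hcoe : ∀ J : Ideal R, J ≠ ⊥ → IsLocalization.coeSubmodule K J ≠ ⊥ := fun J hJ => by
    rwa [ne_eq, ← IsLocalization.coeSubmodule_bot K (R := R),
      (IsFractionRing.coeSubmodule_injective R K).eq_iff]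
  have hH : ∀ m, hilbertFunction I m =
      len (IsLocalization.coeSubmodule K (I ^ m)) (IsLocalization.coeSubmodule K (I ^ (m + 1))) :=
    fun m => (len_map_map (Algebra.linearMap R K) (IsFractionRing.injective R K) _ _).symm
  set F : ℕ → Submodule R K := fun m => Submodule.span R {algebraMap R K x ^ m} * B with hF
  have hF0 : F 0 = B := by
    simp only [hF, pow_zero, ← Submodule.one_eq_span, one_mul]
  have hFsucc : ∀ m, F (m + 1) ≤ F m := by
    intro m z hz
    obtain ⟨w, hw, rfl⟩ := Submodule.mem_span_singleton_mul.1 hz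
    refine Submodule.mem_span_singleton_mul.2 ⟨x • w, B.smul_mem x hw, ?_⟩
    rw [Algebra.smul_def]
    ring
  have hFlen : ∀ m, len (F m) (F (m + 1)) = len B (F 1) := by
    intro m
    have : F (m + 1) = Submodule.span R {algebraMap R K x ^ m} * F 1 := by
      simp only [hF]
      rw [← mul_assoc, Submodule.span_mul_span, Set.singleton_mul_singleton, ← pow_add]
    rw [this, len_span_singleton_mul (pow_ne_zero m hxK)]
  have hFfg : ∀ m, (F m).FG := fun m => (Submodule.fg_span_singleton _).mul hBfg
  have hFbot : ∀ m, F m ≠ ⊥ := fun m => by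
    rw [ne_eq, Submodule.mul_eq_bot, not_or, Submodule.span_singleton_eq_bot]
    exact ⟨pow_ne_zero m hxK, hB0⟩
  obtain ⟨h, hh, hder⟩ := exists_isHPolynomial I (N := N) (e := len B (F 1)) fun m hm => by
    rw [hH, hB m hm, hB (m + 1) (by lia)]
    exact hFlen m
  refine ⟨h, hh, ?_⟩
  have hsumF := sum_len_antitone (antitone_nat_of_succ_le hFsucc)
    (fun i j => hfin (hFfg i) (hFbot j)) N
  have hsumI := sum_len_antitone (F := fun m => IsLocalization.coeSubmodule K (I ^ m))
    (fun a b hab => IsLocalization.coeSubmodule_mono K (Ideal.pow_le_pow_right hab))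
    (fun i j => hfin ((IsLocalization.coeSubmodule_fg K (IsFractionRing.injective R K) _).2
      (IsNoetherian.noetherian _)) (hcoe _ (pow_ne_zero j hI))) N
  simp only [← hH, hFlen, Finset.sum_const, Finset.card_range, smul_eq_mul, pow_zero,
    Ideal.one_eq_top, IsLocalization.coeSubmodule_top, hB N le_rfl, hF0] at hsumF hsumI
  have hFN : F N ≤ 1 := by
    simp only [hF]
    rw [← hB N le_rfl, ← IsLocalization.coeSubmodule_top]
    exact IsLocalization.coeSubmodule_mono K le_top
  -- As x^N B = I^N ⊆ R ⊆ B, the difference N e - ℓ(R/I^N) is ℓ(B/R).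
  have hadd := len_add hFN h1 (hfin hBfg (hFbot N))
  rw [hder]
  have hsumI' : (∑ m ∈ Finset.range N, (hilbertFunction I m : ℤ)) = len 1 (F N) := by
    rw [← Nat.cast_sum, hsumI]
  rw [hsumI']
  have : (N : ℤ) * len B (F 1) = len B (F N) := by exact_mod_cast hsumF
  rw [this, hadd]
  push_cast
  ring

end Reduction

/-! ### The value semigroup, the conductor and the type sequence -/

section Valuation

variable {R K : Type*} [CommRing R] [Field K] [Algebra R K]
  [IsDiscreteValuationRing (integralClosure R K)]

theorem mem_values_one {k : ℕ} : k ∈ values K (1 : Submodule R K) ↔ ∃ x : R, val K x = k := by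
  simp [values, Submodule.mem_one]

theorem val_eq_zero_iff [FaithfulSMul R K] {x : R} : val K x = 0 ↔ IsUnit x := by
  have : FaithfulSMul R (integralClosure R K) :=
    (faithfulSMul_iff_algebraMap_injective R _).2 fun a b h =>
      FaithfulSMul.algebraMap_injective R K (congrArg Subtype.val h)
  rw [val, IsDiscreteValuationRing.addVal_eq_zero_iff, isUnit_map_iff]

theorem val_eq_top_iff [FaithfulSMul R K] {x : R} : val K x = ⊤ ↔ x = 0 := by
  have h : Function.Injective (algebraMap R (integralClosure R K)) := fun a b h =>
    FaithfulSMul.algebraMap_injective R K (congrArg Subtype.val h)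
  rw [val, IsDiscreteValuationRing.addVal_eq_top_iff, map_eq_zero_iff _ h]

theorem mem_Ri {i : ℕ} {x : R} : x ∈ Ri R K i ↔ (s R K i : ℕ∞) ≤ val K x := Iff.rfl

/-- Residual rationality: elements of the same value agree up to a scalar and higher order terms. -/
theorem exists_lt_val_sub
    (hres : Function.Surjective
      ((IsLocalRing.residue (integralClosure R K)).comp (algebraMap R (integralClosure R K))))
    {y z : R} {k : ℕ} (hy : val K y = k) (hz : val K z = k) :
    ∃ a : R, (k : ℕ∞) < val K (z - a * y) := by
  obtain ⟨u, hu⟩ := IsDiscreteValuationRing.addVal_le_iff_dvd.1 (hy.trans hz.symm).le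
  obtain ⟨a, ha⟩ := hres (IsLocalRing.residue _ u)
  refine ⟨a, ?_⟩
  have heq : algebraMap R (integralClosure R K) (z - a * y) =
      algebraMap R _ y * (u - algebraMap R _ a) := by
    rw [map_sub, map_mul, hu]
    ring
  -- The scalar a was chosen with the same residue as u = z/y, so u - a is not a unit.
  have hne : IsDiscreteValuationRing.addVal (integralClosure R K) (u - algebraMap R _ a) ≠ 0 := by
    rw [ne_eq, IsDiscreteValuationRing.addVal_eq_zero_iff, ← mem_nonunits_iff,
      ← IsLocalRing.mem_maximalIdeal, ← IsLocalRing.residue_eq_zero_iff, map_sub, sub_eq_zero]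
    exact ha.symm
  have hy' : IsDiscreteValuationRing.addVal (integralClosure R K) (algebraMap R _ y) = k := hy
  rw [val, heq, IsDiscreteValuationRing.addVal_mul, hy']
  calc (k : ℕ∞) < (k + 1 : ℕ) := Nat.cast_lt.2 k.lt_succ_self
    _ = k + 1 := by push_cast; rfl
    _ ≤ _ := by gcongr; exact Order.one_le_iff_pos.2 (pos_iff_ne_zero.2 hne)

variable [IsDomain R] [IsFractionRing R K]
  [Module.Finite R (integralClosure R K)]

/-- The conductor is a principal ideal of the integral closure. -/
theorem exists_conductor_generator :
    ∃ g : R, g ≠ 0 ∧ ∀ x : K, x ∈ conductor R K ↔ ∃ w ∈ Rbar R K, x = algebraMap R K g * w := by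
  -- The conductor is stable under R̄, hence an ideal of a principal ideal ring.
  have hsmul : ∀ a b : integralClosure R K, (b : K) ∈ conductor R K →
      ((a * b : integralClosure R K) : K) ∈ conductor R K := fun a b hb =>
    mem_dual.2 fun y hy => by
      obtain ⟨e, he⟩ := mem_dual.1 hb _ ((integralClosure R K).mul_mem a.2 hy)
      exact ⟨e, by rw [he]; push_cast; ring⟩
  let 𝔠 : Ideal (integralClosure R K) :=
    { carrier := {w | (w : K) ∈ conductor R K}
      zero_mem' := (conductor R K).zero_mem
      add_mem' := fun ha hb => (conductor R K).add_mem ha hb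
      smul_mem' := fun a b hb => hsmul a b hb }
  have hmem : ∀ w : integralClosure R K, w ∈ 𝔠 ↔ (w : K) ∈ conductor R K := fun w => Iff.rfl
  have hone : ∀ x ∈ conductor R K, ∃ b : R, algebraMap R K b = x := fun x hx => by
    simpa using mem_dual.1 hx 1 (Submodule.one_le.1 one_le_Rbar)
  obtain ⟨g', hg'⟩ := IsPrincipalIdealRing.principal 𝔠
  have hgc : (g' : K) ∈ conductor R K := (hmem g').1 (hg' ▸ Submodule.mem_span_singleton_self g')
  obtain ⟨g, hg⟩ := hone _ hgc
  refine ⟨g, ?_, fun x => ⟨fun hx => ?_, ?_⟩⟩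
  · rintro rfl
    obtain ⟨x, hx, hx0⟩ := (Submodule.ne_bot_iff _).1 (dual_ne_bot (fg_Rbar (R := R) (K := K)))
    obtain ⟨b, rfl⟩ := hone x hx
    have hb : algebraMap R (integralClosure R K) b ∈ 𝔠 := hx
    have hg0 : g' = 0 := Subtype.ext (by simpa using hg.symm)
    rw [hg', hg0, Submodule.mem_span_singleton] at hb
    obtain ⟨a, ha⟩ := hb
    rw [smul_zero] at ha
    exact hx0 (congrArg Subtype.val ha).symm
  · obtain ⟨b, rfl⟩ := hone x hx
    have hb : algebraMap R (integralClosure R K) b ∈ 𝔠 := hx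
    rw [hg', Submodule.mem_span_singleton] at hb
    obtain ⟨a, ha⟩ := hb
    refine ⟨a, a.2, ?_⟩
    rw [hg, mul_comm]
    exact (congrArg Subtype.val ha).symm
  · rintro ⟨w, hw, rfl⟩
    have := hsmul ⟨w, hw⟩ g' hgc
    rw [hg, mul_comm]
    exact this

/-- Writing γ_R = gR̄, the condition xgR̄ ⊆ R says xg ∈ γ_R = gR̄, so x ∈ R̄. -/
theorem dual_conductor : dual K (conductor R K) = Rbar R K := by
  obtain ⟨g, hg0, hg⟩ := exists_conductor_generator (R := R) (K := K)
  have hgK : algebraMap R K g ≠ 0 := by simpa using hg0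
  refine le_antisymm (fun x hx => ?_) (le_dual_dual _)
  have hmem : algebraMap R K g * x ∈ conductor R K := mem_dual.2 fun y hy => by
    obtain ⟨b, hb⟩ := mem_dual.1 hx _ ((hg _).2 ⟨y, hy, rfl⟩)
    exact ⟨b, by rw [hb]; ring⟩
  obtain ⟨w, hw, hxw⟩ := (hg _).1 hmem
  rwa [mul_left_cancel₀ hgK hxw]

/-- The elements g ϖ^(k+1) of the conductor lie in R and have value greater than k. Infinitude makes
`Nat.nth` a true enumeration, without its default value 0. -/
theorem infinite_values_one : (Set.ofPred (· ∈ values K (1 : Submodule R K))).Infinite := by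
  obtain ⟨g, hg0, hg⟩ := exists_conductor_generator (R := R) (K := K)
  obtain ⟨ϖ, hϖ⟩ := IsDiscreteValuationRing.exists_irreducible (integralClosure R K)
  refine Set.infinite_of_forall_exists_gt fun k => ?_
  obtain ⟨b, hb⟩ : ∃ b : R, algebraMap R K b = algebraMap R K g * (ϖ ^ (k + 1) :) := by
    simpa using mem_dual.1 ((hg _).2 ⟨_, (ϖ ^ (k + 1)).2, rfl⟩) 1 (Submodule.one_le.1 one_le_Rbar)
  have hb' : algebraMap R (integralClosure R K) b = algebraMap R _ g * ϖ ^ (k + 1) := Subtype.ext hb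
  have hval : val K b = val K g + (k + 1 : ℕ) := by
    rw [val, hb', IsDiscreteValuationRing.addVal_mul, hϖ.addVal_pow, val]
  obtain ⟨e, he⟩ := ENat.ne_top_iff_exists.1 (mt (val_eq_top_iff (K := K)).1 hg0)
  refine ⟨e + (k + 1), mem_values_one.2 ⟨b, ?_⟩, by lia⟩
  rw [hval, ← he]
  rfl

theorem s_strictMono : StrictMono (s R K) := Nat.nth_strictMono infinite_values_one

theorem exists_val_eq_s (i : ℕ) : ∃ x : R, val K x = s R K i :=
  mem_values_one.1 (Nat.nth_mem_of_infinite infinite_values_one i)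

theorem exists_s_eq {k : ℕ} (hk : ∃ x : R, val K x = k) : ∃ i, s R K i = k := by
  have : k ∈ Set.range (Nat.nth (· ∈ values K (1 : Submodule R K))) := by
    rw [Nat.range_nth_of_infinite infinite_values_one]
    exact mem_values_one.2 hk
  exact this

theorem s_zero : s R K 0 = 0 := by
  obtain ⟨i, hi⟩ := exists_s_eq (R := R) (K := K) (k := 0)
    ⟨1, by rw [Nat.cast_zero, val_eq_zero_iff]; exact isUnit_one⟩
  have := (s_strictMono (R := R) (K := K)).monotone (Nat.zero_le i)
  lia

theorem s_succ_le_val {i : ℕ} {x : R} (h : (s R K i : ℕ∞) < val K x) :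
    (s R K (i + 1) : ℕ∞) ≤ val K x := by
  rcases eq_or_ne (val K x) ⊤ with h' | h'
  · rw [h']
    exact le_top
  obtain ⟨k, hk⟩ := ENat.ne_top_iff_exists.1 h'
  obtain ⟨j, hj⟩ := exists_s_eq (R := R) (K := K) ⟨x, hk.symm⟩
  rw [← hk, ← hj, Nat.cast_lt, s_strictMono.lt_iff_lt] at h
  rw [← hk, ← hj, Nat.cast_le, s_strictMono.le_iff_le]
  exact h

theorem Ri_antitone : Antitone (Ri R K) := fun _ _ hij _ hx =>
  (Nat.cast_le.2 (s_strictMono.monotone hij)).trans (mem_Ri.1 hx)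

theorem Ri_ne_bot (i : ℕ) : Ri R K i ≠ ⊥ := by
  obtain ⟨x, hx⟩ := exists_val_eq_s (R := R) (K := K) i
  refine (Submodule.ne_bot_iff _).2 ⟨x, mem_Ri.2 hx.ge, ?_⟩
  rintro rfl
  rw [(val_eq_top_iff (K := K)).2 rfl] at hx
  exact ENat.top_ne_natCast _ hx

theorem Ri_zero : Ri R K 0 = ⊤ := by
  ext x
  simp [mem_Ri, s_zero]

theorem Ri_one [IsLocalRing R] : Ri R K 1 = IsLocalRing.maximalIdeal R := by
  ext x
  rw [mem_Ri, IsLocalRing.mem_maximalIdeal, mem_nonunits_iff, ← val_eq_zero_iff (K := K)]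
  constructor
  · intro h h0
    have := (s_strictMono (R := R) (K := K)) Nat.zero_lt_one
    rw [h0, nonpos_iff_eq_zero, Nat.cast_eq_zero] at h
    lia
  · intro h
    refine s_succ_le_val ?_
    rw [s_zero, Nat.cast_zero]
    exact pos_iff_ne_zero.2 h

theorem RiDual_zero : RiDual R K 0 = 1 := by
  rw [RiDual, Ri_zero, IsLocalization.coeSubmodule_top, dual_one]

theorem coe_Ri_ne_bot (i : ℕ) : IsLocalization.coeSubmodule K (Ri R K i) ≠ ⊥ := by
  rw [ne_eq, ← IsLocalization.coeSubmodule_bot K (R := R),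
    (IsFractionRing.coeSubmodule_injective R K).eq_iff]
  exact Ri_ne_bot i

theorem RiDual_mono : Monotone (RiDual R K) := fun _ _ hij =>
  dual_anti (IsLocalization.coeSubmodule_mono K (Ri_antitone hij))

theorem fg_RiDual [IsNoetherianRing R] (i : ℕ) : (RiDual R K i).FG := fg_dual (coe_Ri_ne_bot i)

theorem one_le_RiDual (i : ℕ) : 1 ≤ RiDual R K i :=
  RiDual_zero (R := R) (K := K) ▸ RiDual_mono i.zero_le

theorem RiDual_ne_bot (i : ℕ) : RiDual R K i ≠ ⊥ :=
  ne_bot_of_le_ne_bot one_ne_zero (one_le_RiDual i)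

theorem sum_r_eq_len [IsNoetherianRing R] (hdim : ringKrullDim R = 1) (k : ℕ) :
    ∑ i ∈ Finset.Icc 1 k, r R K i = len (RiDual R K k) 1 := by
  have h := sum_len_telescope (F := RiDual R K) RiDual_mono
    (fun i j => length_ne_top_of_fg hdim (fg_RiDual i) (RiDual_ne_bot j)) k
  rw [RiDual_zero] at h
  simpa only [r] using h

theorem r_one [IsLocalRing R] :
    r R K 1 = len (dual K (IsLocalization.coeSubmodule K (IsLocalRing.maximalIdeal R))) 1 := by
  rw [r, Nat.sub_self, RiDual_zero, RiDual, Ri_one]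

/-- Elements of R_i outside R_{i+1} have value exactly s_i, and any two of them agree up to a scalar
modulo R_{i+1}. -/
theorem Ri_succ_covBy
    (hres : Function.Surjective
      ((IsLocalRing.residue (integralClosure R K)).comp (algebraMap R (integralClosure R K))))
    (i : ℕ) : Ri R K (i + 1) ⋖ Ri R K i := by
  have hle : Ri R K (i + 1) ≤ Ri R K i := Ri_antitone i.le_succ
  refine ⟨lt_of_le_not_ge hle fun h => ?_, fun C h1 h2 => h2.not_ge fun z hz => ?_⟩
  · obtain ⟨x, hx⟩ := exists_val_eq_s (R := R) (K := K) i
    have := mem_Ri.1 (h (mem_Ri.2 hx.ge))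
    rw [hx, Nat.cast_le] at this
    exact this.not_gt (s_strictMono i.lt_succ_self)
  · have hval : ∀ {w : R}, w ∈ Ri R K i → w ∉ Ri R K (i + 1) → val K w = s R K i :=
      fun hw hw' => ((mem_Ri.1 hw).eq_or_lt.resolve_right fun h => hw' (s_succ_le_val h)).symm
    obtain ⟨y, hyC, hy⟩ := Set.exists_of_ssubset h1
    by_cases hz' : z ∈ Ri R K (i + 1)
    · exact h1.le hz'
    obtain ⟨a, ha⟩ := exists_lt_val_sub hres (hval (h2.le hyC) hy) (hval hz hz')
    have := C.add_mem (h1.le (mem_Ri.2 (s_succ_le_val ha))) (C.mul_mem_left a hyC)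
    rwa [sub_add_cancel] at this

/-- If g generates γ_R over R̄ and v(g) = s_j, then γ_R = R_j. The j simple steps from R down to R_j
give n = j, and dualising γ_R returns R̄. -/
theorem RiDual_n_eq_Rbar [IsNoetherianRing R] (hdim : ringKrullDim R = 1)
    (hres : Function.Surjective
      ((IsLocalRing.residue (integralClosure R K)).comp (algebraMap R (integralClosure R K)))) :
    RiDual R K (n R K) = Rbar R K := by
  obtain ⟨g, hg0, hg⟩ := exists_conductor_generator (R := R) (K := K)
  obtain ⟨e, he⟩ := ENat.ne_top_iff_exists.1 (mt (val_eq_top_iff (K := K)).1 hg0)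
  obtain ⟨j, hj⟩ := exists_s_eq (R := R) (K := K) ⟨g, he.symm⟩
  have hcond : conductor R K = IsLocalization.coeSubmodule K (Ri R K j) := by
    ext x
    rw [IsLocalization.mem_coeSubmodule]
    constructor
    · intro hx
      obtain ⟨b, hb⟩ : ∃ b : R, algebraMap R K b = x := by
        simpa using mem_dual.1 hx 1 (Submodule.one_le.1 one_le_Rbar)
      obtain ⟨w, hw, hxw⟩ := (hg x).1 hx
      refine ⟨b, mem_Ri.2 ?_, hb⟩
      rw [hj, he]
      exact IsDiscreteValuationRing.addVal_le_iff_dvd.2 ⟨⟨w, hw⟩, Subtype.ext (hb.trans hxw)⟩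
    · rintro ⟨b, hb, rfl⟩
      rw [mem_Ri, hj, he] at hb
      obtain ⟨w, hw⟩ := IsDiscreteValuationRing.addVal_le_iff_dvd.1 hb
      exact (hg _).2 ⟨w, w.2, congrArg Subtype.val hw⟩
  have hn : n R K = j := by
    have hsum := sum_len_antitone (F := fun i => IsLocalization.coeSubmodule K (Ri R K i))
      (fun a b hab => IsLocalization.coeSubmodule_mono K (Ri_antitone hab))
      (fun i j => length_ne_top_of_fg hdim
        ((IsLocalization.coeSubmodule_fg K (IsFractionRing.injective R K) _).2
          (IsNoetherian.noetherian _)) (coe_Ri_ne_bot j)) j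
    have hone : ∀ i, len (IsLocalization.coeSubmodule K (Ri R K i))
        (IsLocalization.coeSubmodule K (Ri R K (i + 1))) = 1 := fun i =>
      (len_map_map (Algebra.linearMap R K) (IsFractionRing.injective R K) _ _).trans
        (len_eq_one_of_covBy (Ri_succ_covBy hres i))
    simp only [hone, Finset.sum_const, Finset.card_range, smul_eq_mul, mul_one, Ri_zero,
      IsLocalization.coeSubmodule_top] at hsum
    rw [n, hcond, ← hsum]
  rw [hn, RiDual, ← hcond, dual_conductor]

end Valuation

end Blowup

/-! ### The main theorem -/

theorem theorem4p4 {R K : Type*} [CommRing R] [IsDomain R] [IsLocalRing R] [IsNoetherianRing R]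
    [Field K] [Algebra R K] [IsFractionRing R K]
    (hdim : ringKrullDim R = 1)
    [Infinite (IsLocalRing.ResidueField R)]
    -- analytically irreducible: the integral closure is finite over `R` and a DVR
    [Module.Finite R (integralClosure R K)]
    [IsDiscreteValuationRing (integralClosure R K)]
    -- residually rational: `R` and its integral closure have the same residue field
    (hres : Function.Surjective
      ((IsLocalRing.residue (integralClosure R K)).comp (algebraMap R (integralClosure R K))))
    -- `I` is primary to the maximal ideal and not principal
    (I : Ideal R) (hI : I.radical = IsLocalRing.maximalIdeal R)
    (hnp : ¬ Submodule.IsPrincipal I) :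
    ∃ (h : ℤ[X]) (ρ : ℤ),
      -- `ρ` is the genus of `I`
      Blowup.IsHPolynomial I h ∧ ρ = (derivative h).eval 1 ∧
      ρ = Blowup.len (Blowup.blowup K I) 1 ∧
      -- the first formula and the bound
      ρ = ∑ i ∈ Finset.Icc 1 (Blowup.n R K) \ Blowup.Gam K I, (Blowup.r R K i : ℤ)
          - Blowup.len (Blowup.dual K (Blowup.dual K (Blowup.blowup K I))) (Blowup.blowup K I)
          - Blowup.d K I ∧
      ρ ≤ (Blowup.r R K 1 : ℤ) * Blowup.len 1 (Blowup.dual K (Blowup.blowup K I)) ∧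
      -- for `Λ = R̄` the bound is that of Matlis
      (Blowup.blowup K I = Blowup.Rbar R K →
        ρ = Blowup.delta R K ∧
        (Blowup.len 1 (Blowup.dual K (Blowup.blowup K I)) : ℤ)
          = (Blowup.c R K : ℤ) - Blowup.delta R K ∧
        (Blowup.delta R K : ℤ)
          ≤ (Blowup.r R K 1 : ℤ) * ((Blowup.c R K : ℤ) - Blowup.delta R K)) ∧
      -- the second formula, where `s_{i₀}` is the smallest value of `R : Λ`
      (∃ i₀ : ℕ,
        IsLeast (Blowup.values K (Blowup.dual K (Blowup.blowup K I))) (Blowup.s R K i₀)) ∧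
      ∀ i₀ : ℕ,
        IsLeast (Blowup.values K (Blowup.dual K (Blowup.blowup K I))) (Blowup.s R K i₀) →
        ρ = ∑ i ∈ Finset.Icc 1 i₀, (Blowup.r R K i : ℤ)
            - Blowup.len (Blowup.dual K (Blowup.dual K (Blowup.blowup K I))) (Blowup.blowup K I)
            + Blowup.len (Blowup.dual K (Blowup.dual K (Blowup.blowup K I)))
                (Blowup.RiDual R K i₀) := by
  have hm : IsLocalRing.maximalIdeal R ≠ ⊥ := by
    intro h0
    have := IsLocalRing.isField_iff_maximalIdeal_eq.2 h0
    rw [ringKrullDim_eq_zero_of_isField this] at hdim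
    exact zero_ne_one hdim
  have hI0 : I ≠ ⊥ := by
    rintro rfl
    exact hm (hI.symm.trans (Ideal.isRadical_bot).radical)
  obtain ⟨⟨h1, hle⟩, h, hh, hder⟩ := Blowup.blowup_le_Rbar_and_genus (K := K) hdim hI0
  have hRbar := Blowup.RiDual_n_eq_Rbar hdim hres
  set Λ := Blowup.blowup K I
  have hfin : ∀ {A B : Submodule R K}, A.FG → B ≠ ⊥ →
      Module.length R (A ⧸ B.submoduleOf A) ≠ ⊤ := Blowup.length_ne_top_of_fg hdim
  have h1fg : (1 : Submodule R K).FG := by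
    rw [Submodule.one_eq_span]
    exact Submodule.fg_span_singleton 1
  have hΛfg : Λ.FG := Blowup.fg_Rbar.of_le hle
  have hΛ0 : Λ ≠ ⊥ := ne_bot_of_le_ne_bot one_ne_zero h1
  have hdual0 : Blowup.dual K Λ ≠ ⊥ := Blowup.dual_ne_bot hΛfg
  have hdual1 : Blowup.dual K Λ ≤ 1 := (Blowup.dual_anti h1).trans Blowup.dual_one.le
  have hddfg : (Blowup.dual K (Blowup.dual K Λ)).FG := Blowup.fg_dual hdual0
  have hΛdd : Λ ≤ Blowup.dual K (Blowup.dual K Λ) := Blowup.le_dual_dual Λ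
  have hdd : Blowup.dual K (Blowup.dual K Λ) ≤ Blowup.Rbar R K := by
    rw [← Blowup.dual_conductor]
    exact Blowup.dual_anti (Blowup.dual_anti hle)
  have hdd1 := Blowup.len_add h1 hΛdd (hfin hddfg one_ne_zero)
  -- Applied to R:Λ ⊆ R, this bounds ℓ(Λ**/R), which dominates ℓ(Λ/R) by `hdd1`.
  have hbound := Blowup.len_dual_le hdim hm h1fg hdual0 hdual1
  rw [Blowup.dual_one, ← Blowup.r_one] at hbound
  have hbound' : Blowup.len Λ 1 ≤ Blowup.r R K 1 * Blowup.len 1 (Blowup.dual K Λ) := by lia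
  have hc : Blowup.c R K = Blowup.delta R K + Blowup.n R K := by
    have hcR : Blowup.conductor R K ≤ 1 :=
      (Blowup.dual_anti Blowup.one_le_Rbar).trans Blowup.dual_one.le
    exact Blowup.len_add hcR Blowup.one_le_Rbar
      (hfin Blowup.fg_Rbar (Blowup.dual_ne_bot Blowup.fg_Rbar))
  refine ⟨h, Blowup.len Λ 1, hh, hder.symm, rfl, ?_, by exact_mod_cast hbound', ?_, ?_, ?_⟩
  · have hsum := Blowup.sum_r_eq_len (R := R) (K := K) hdim (Blowup.n R K)
    rw [hRbar] at hsum
    have hsplit := Finset.sum_sdiff (f := fun i => (Blowup.r R K i : ℤ))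
      (show Blowup.Gam K I ⊆ Finset.Icc 1 (Blowup.n R K) by
        classical exact Finset.filter_subset _ _)
    have hadd1 := Blowup.len_add (h1.trans hΛdd) hdd (hfin Blowup.fg_Rbar one_ne_zero)
    have hsum' : ∑ i ∈ Finset.Icc 1 (Blowup.n R K), (Blowup.r R K i : ℤ) =
        Blowup.len (Blowup.Rbar R K) 1 := by exact_mod_cast hsum
    rw [Blowup.d]
    change _ = _ - _ - ((Blowup.len (Blowup.Rbar R K) (Blowup.dual K (Blowup.dual K Λ)) : ℤ) - _)
    lia
  · intro hΛ
    rw [hΛ] at hbound' ⊢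
    have hn : Blowup.len 1 (Blowup.dual K (Blowup.Rbar R K)) = Blowup.n R K := rfl
    have hδ : Blowup.len (Blowup.Rbar R K) 1 = Blowup.delta R K := rfl
    rw [hn, hδ] at hbound'
    have hcδ : (Blowup.c R K : ℤ) - Blowup.delta R K = Blowup.n R K := by lia
    rw [hn, hδ, hcδ]
    exact ⟨rfl, rfl, by exact_mod_cast hbound'⟩
  · obtain ⟨a, ha, haΛ⟩ := Blowup.exists_ne_zero_algebraMap_mem hdual0
    obtain ⟨e, he⟩ := ENat.ne_top_iff_exists.1 (mt (Blowup.val_eq_top_iff (K := K)).1 ha)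
    have hne : (Blowup.values K (Blowup.dual K Λ)).Nonempty := ⟨e, a, haΛ, he.symm⟩
    obtain ⟨x, -, hx⟩ := Nat.sInf_mem hne
    obtain ⟨i, hi⟩ := Blowup.exists_s_eq (R := R) (K := K) ⟨x, hx⟩
    exact ⟨i, hi ▸ ⟨Nat.sInf_mem hne, fun k hk => Nat.sInf_le hk⟩⟩
  · intro i hi
    -- Minimality of s_i says R:Λ ⊆ R_i; the zero element, of value ⊤, is not counted among the
    -- values and is treated apart.
    have hle_i : Blowup.RiDual R K i ≤ Blowup.dual K (Blowup.dual K Λ) := by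
      refine Blowup.dual_anti fun x hx => ?_
      obtain ⟨b, rfl⟩ := Submodule.mem_one.1 (hdual1 hx)
      refine (IsLocalization.mem_coeSubmodule K _).2 ⟨b, Blowup.mem_Ri.2 ?_, rfl⟩
      rcases eq_or_ne (Blowup.val K b) ⊤ with hb | hb
      · rw [hb]
        exact le_top
      · obtain ⟨k, hk⟩ := ENat.ne_top_iff_exists.1 hb
        rw [← hk, Nat.cast_le]
        exact hi.2 ⟨b, hx, hk.symm⟩
    have hadd := Blowup.len_add (Blowup.one_le_RiDual i) hle_i (hfin hddfg one_ne_zero)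
    have hsum : ∑ j ∈ Finset.Icc 1 i, (Blowup.r R K j : ℤ) = Blowup.len (Blowup.RiDual R K i) 1 := by
      exact_mod_cast Blowup.sum_r_eq_len (R := R) (K := K) hdim i
    lia
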